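/- Let $(\ell_k)_{k\in\mathbb N_0}\subseteq\mathbb N=\{1,2,\dots\}$, $L\in\mathbb N$, $\mathbf d_k=\sum_{n=1}^{k}\ell_n(\ell_{n-1}+1)$ and $\mathfrak d=\mathbf d_L$. For $\theta\in\mathbb R^{\mathfrak d}$, $k\in\{1,\dots,L\}$, $i\in\{1,\dots,\ell_k\}$, $j\in\{1,\dots,\ell_{k-1}\}$ let $$\mathfrak w^{k,\theta}_{i,j}=\theta_{(i-1)\ell_{k-1}+j+\mathbf d_{k-1}},\qquad \mathfrak b^{k,\theta}_i=\theta_{\ell_k\ell_{k-1}+i+\mathbf d_{k-1}}.$$ Let $S\subseteq\mathbb R$ be finite and let $\mathbf g\colon S\to\mathbb R$ and $A_n\colon\mathbb R\to\mathbb R$, $n\in\mathbb N_0$, be functions such that $A_n\in C^1(\mathbb R,\mathbb R)$ for all $n\ge 1$ and $A_0|_{\mathbb R\setminus S}\in C^1(\mathbb R\setminus S,\mathbb R)$. Let $a\colon\mathbb R\to\mathbb R$ be given by $a(x)=(A_0)'(x)$ for $x\notin S$ and $a(x)=\mathbf g(x)$ for $x\in S$. Assume (1) for every $x\in\mathbb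 R$ there is $m\in\mathbb N$ such that $A_n(x)=A_0(x)$ and $(A_n)'(x)=a(x)$ for all $n\ge m$; (2) for every $m\in\mathbb N$ it holds that $\sup_{n\in\mathbb N}\sup_{x\in[-m,m]}\bigl(|A_n(x)|+|(A_n)'(x)|\bigr)<\infty$; (3) $\min_{z\in\{-1,1\}}\sum_{x\in S}\limsup_{h\searrow0}|a(x+zh)-a(x)|=0$. For $n\in\mathbb N_0$, $\theta\in\mathbb R^{\mathfrak d}$ let $\mathcal N_n^{k,\theta}\colon\mathbb R^{\ell_0}\to\mathbb R^{\ell_k}$, $k\in\{1,\dots,L\}$, be given by $\mathcal N^{1,\theta}_{n,i}(x)=\mathfrak b^{1,\theta}_i+\sum_{j=1}^{\ell_0}\mathfrak w^{1,\theta}_{i,j}x_j$ and $\mathcal N^{k+1,\theta}_{n,i}(x)=\mathfrak b^{k+1,\theta}_i+\sum_{j=1}^{\ell_k}\mathfrak w^{k+1,\theta}_{i,j}A_n(\mathcal N^{k,\theta}_{n,j}(x))$ for $1\le k<L$. Let $\mu$ be a finite Borel measure on $\mathbb R^{\ell_0}\times\mathbb R^{\ell_L}$ such that $\{x\in\mathbb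 R^{\ell_0}\colon\exists\,y\in\mathbb R^{\ell_L}\colon(x,y)\in\operatorname{supp}(\mu)\}$ is bounded. Let $H\in C^1(\mathbb R^{\ell_L}\times\mathbb R^{\mathfrak d}\times\mathbb R^{\ell_L},\mathbb R)$, $(z,\theta,y)\mapsto H(z,\theta,y)$, be such that $\int|H(\mathcal N_n^{L,\theta}(x),\theta,y)|\,\mu(\mathrm dx,\mathrm dy)<\infty$ for all $n\in\mathbb N_0$, $\theta\in\mathbb R^{\mathfrak d}$, and such that for all $r\in(0,\infty)$, $X\in[-r,r]^{\ell_L}$, $\Theta\in[-r,r]^{\mathfrak d}$ there is $C\in\mathbb R$ such that for all $z\in[-r,r]^{\ell_L}$, $\theta\in[-r,r]^{\mathfrak d}$, $(x,y)\in\operatorname{supp}(\mu)$ $$\frac{\|\nabla_zH(z,\theta,y)\|+\|\nabla_\theta H(z,\theta,y)\|}{1+|H(X,\Theta,y)|}\le C.$$ For $n\in\mathbb N_0$ let $\mathcal L_n\colon\mathbb R^{\mathfrak d}\to\mathbb R$ be given by $\mathcal L_n(\theta)=\int H(\mathcal N_n^{L,\theta}(x),\theta,y)\,\mu(\mathrm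 dx,\mathrm dy)$, and let $\mathcal G\colon\mathbb R^{\mathfrak d}\to\mathbb R^{\mathfrak d}$ satisfy $\mathcal G(\theta)=\lim_{n\to\infty}(\nabla\mathcal L_n)(\theta)$ for every $\theta$ at which the gradients $(\nabla\mathcal L_n)(\theta)$, $n\in\mathbb N$, exist and converge. Then for every open $U\subseteq\mathbb R^{\mathfrak d}$ with $\mathcal L_0|_U\in C^1(U,\mathbb R)$ and every $\theta\in U$ it holds that $\mathcal G(\theta)=(\nabla\mathcal L_0)(\theta)$. -/

import Mathlib

open MeasureTheory Filter Topology

noncomputable section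

namespace ANN

/-- The generalized derivative of `f` on the real line: it is the prescribed value `γ x` at the
points `x` of the finite exceptional set `S`, and the usual derivative of `f` elsewhere. -/
def genDeriv (S : Finset ℝ) (γ : S → ℝ) (f : ℝ → ℝ) (x : ℝ) : ℝ :=
  if h : x ∈ S then γ ⟨x, h⟩ else deriv f x

/-- `∑_{x ∈ S} limsup_{h ↘ 0} |a (x + z h) - a x|`, as an element of `[0, ∞]`. -/
def oneSidedJump (S : Finset ℝ) (a : ℝ → ℝ) (z : ℝ) : ENNReal :=
  ∑ x ∈ S, limsup (fun h : ℝ => ENNReal.ofReal |a (x + z * h) - a x|) (𝓝[>] (0 : ℝ))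

/-- Number of parameters of the first `k` affine layers of a network with layer widths
`ℓ 0, ℓ 1, ℓ 2, …`, that is `∑_{n=1}^k ℓ n * (ℓ (n-1) + 1)`. -/
def paramDim (ℓ : ℕ → ℕ) (k : ℕ) : ℕ :=
  ∑ n ∈ Finset.range k, ℓ (n + 1) * (ℓ n + 1)

/-- The coordinate of the parameter vector with (zero-based) number `m`. -/
def coord {d : ℕ} (θ : EuclideanSpace ℝ (Fin d)) (m : ℕ) : ℝ :=
  if h : m < d then θ ⟨m, h⟩ else 0

/-- Entry `(i, j)` of the weight matrix of the affine map from layer `k` to layer `k + 1`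
(all indices are zero-based). -/
def weight (ℓ : ℕ → ℕ) {d : ℕ} (θ : EuclideanSpace ℝ (Fin d)) (k : ℕ)
    (i : Fin (ℓ (k + 1))) (j : Fin (ℓ k)) : ℝ :=
  coord θ (i * ℓ k + j + paramDim ℓ k)

/-- Entry `i` of the bias vector of the affine map from layer `k` to layer `k + 1`
(all indices are zero-based). -/
def bias (ℓ : ℕ → ℕ) {d : ℕ} (θ : EuclideanSpace ℝ (Fin d)) (k : ℕ)
    (i : Fin (ℓ (k + 1))) : ℝ :=
  coord θ (ℓ (k + 1) * ℓ k + i + paramDim ℓ k)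

/-- The parameters of the first `L` affine maps are genuine coordinates of a vector of
`paramDim ℓ L` entries, so the default value in `coord` is not used for them. -/
theorem bias_index_lt (ℓ : ℕ → ℕ) {k L : ℕ} (hk : k < L) (i : Fin (ℓ (k + 1))) :
    ℓ (k + 1) * ℓ k + i + paramDim ℓ k < paramDim ℓ L := by
  have h1 : paramDim ℓ (k + 1) ≤ paramDim ℓ L :=
    Finset.sum_le_sum_of_subset (Finset.range_mono hk)
  have h2 : paramDim ℓ (k + 1) = paramDim ℓ k + ℓ (k + 1) * (ℓ k + 1) :=
    Finset.sum_range_succ _ _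
  have h3 := i.isLt
  rw [mul_add, mul_one] at h2
  omega

theorem weight_index_lt (ℓ : ℕ → ℕ) {k L : ℕ} (hk : k < L) (i : Fin (ℓ (k + 1)))
    (j : Fin (ℓ k)) : i * ℓ k + j + paramDim ℓ k < paramDim ℓ L := by
  have h1 := bias_index_lt ℓ hk i
  have h2 := j.isLt
  have h3 : ((i : ℕ) + 1) * ℓ k ≤ ℓ (k + 1) * ℓ k := Nat.mul_le_mul_right _ i.isLt
  rw [add_mul, one_mul] at h3
  omega

/-- The affine map from layer `k` to layer `k + 1`. -/
def affineLayer (ℓ : ℕ → ℕ) {d : ℕ} (θ : EuclideanSpace ℝ (Fin d)) (k : ℕ)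
    (v : Fin (ℓ k) → ℝ) (i : Fin (ℓ (k + 1))) : ℝ :=
  bias ℓ θ k i + ∑ j, weight ℓ θ k i j * v j

/-- The preactivations in layer `k` of the fully connected feedforward network with layer widths
`ℓ`, activation `A` and parameters `θ` on input `x`. The activation is applied in the hidden layers
only: it is applied neither to the input nor after the last affine map. -/
def preact (ℓ : ℕ → ℕ) {d : ℕ} (A : ℝ → ℝ) (θ : EuclideanSpace ℝ (Fin d))
    (x : EuclideanSpace ℝ (Fin (ℓ 0))) : (k : ℕ) → Fin (ℓ k) → ℝ
  | 0 => fun i => x i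
  | 1 => affineLayer ℓ θ 0 (fun j => x j)
  | k + 2 => affineLayer ℓ θ (k + 1) (fun j => A (preact ℓ A θ x (k + 1) j))

/-- The realization function of the network with `L` affine layers. -/
def realization (ℓ : ℕ → ℕ) (L : ℕ) (A : ℝ → ℝ) (θ : EuclideanSpace ℝ (Fin (paramDim ℓ L)))
    (x : EuclideanSpace ℝ (Fin (ℓ 0))) : EuclideanSpace ℝ (Fin (ℓ L)) :=
  WithLp.toLp 2 (preact ℓ A θ x L)

/-- The objective function `θ ↦ ∫ H(N^{L,θ}(x), θ, y) μ(dx, dy)`. -/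
def risk (ℓ : ℕ → ℕ) (L : ℕ)
    (H : EuclideanSpace ℝ (Fin (ℓ L)) × EuclideanSpace ℝ (Fin (paramDim ℓ L)) ×
      EuclideanSpace ℝ (Fin (ℓ L)) → ℝ)
    (μ : Measure (EuclideanSpace ℝ (Fin (ℓ 0)) × EuclideanSpace ℝ (Fin (ℓ L))))
    (A : ℝ → ℝ) (θ : EuclideanSpace ℝ (Fin (paramDim ℓ L))) : ℝ :=
  ∫ p, H (realization ℓ L A θ p.1, θ, p.2) ∂μ

end ANN

end

/-!
Once a slope function is prescribed for the activation, the chain rule produces a formal derivative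
of the sample loss, which depends only on the values and slopes of the activation at the finitely
many preactivations of the sample. For each sample the smooth approximations eventually have the
right values and slopes there, so by dominated convergence the gradients of the approximating risks
tend to the integral of the formal derivative that uses the slope function `a` of the limit.

At `θ` itself this formal derivative need not be the derivative of the sample loss, since
preactivations may hit the exceptional set `S` for a set of samples of positive measure. It is the
derivative at parameters `θ'` for which almost all samples avoid `S`. Arbitrarily close to `θ` there
are such `θ'` that move every preactivation strictly to the side from which `a` is continuous:
shift the biases layer by layer, each shift dominating the displacement caused by earlier ones.
By Fubini almost every size of the shift avoids the countable set `S`. Along such `θ' → θ` the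
formal derivatives converge, and so do the gradients of the limit risk because it is `C¹`.
-/

namespace ANN

open Metric Set
open scoped NNReal

section UniformlyLipschitzOnBounded

variable {ι E F G : Type*} [NormedAddCommGroup E] [NormedAddCommGroup F] [NormedAddCommGroup G]

/-- A family of functions is uniformly Lipschitz on bounded sets if on every ball around the origin
its members are bounded and Lipschitz with a constant that does not depend on the member. Both
bounds are recorded because together they are stable under composition. -/
def UniformlyLipschitzOnBounded (f : ι → E → F) : Prop :=
  ∀ r : ℝ, ∃ C : ℝ≥0, ∀ i, LipschitzOnWith C (f i) (closedBall 0 r) ∧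
    MapsTo (f i) (closedBall 0 r) (closedBall 0 C)

namespace UniformlyLipschitzOnBounded

variable {f : ι → E → F}

theorem reindex {κ : Type*} (hf : UniformlyLipschitzOnBounded f) (e : κ → ι) :
    UniformlyLipschitzOnBounded fun k => f (e k) := fun r =>
  (hf r).imp fun _ hC k => hC (e k)

theorem comp {g : ι → F → G} (hg : UniformlyLipschitzOnBounded g)
    (hf : UniformlyLipschitzOnBounded f) : UniformlyLipschitzOnBounded fun i => g i ∘ f i := by
  intro r
  obtain ⟨C, hC⟩ := hf r
  obtain ⟨D, hD⟩ := hg C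
  refine ⟨max (D * C) D, fun i => ⟨?_, ?_⟩⟩
  · exact ((hD i).1.comp (hC i).1 (hC i).2).weaken (le_max_left _ _)
  · exact ((hD i).2.comp (hC i).2).mono_right (closedBall_subset_closedBall (le_max_right _ _))

theorem prodMk {g : ι → E → G} (hf : UniformlyLipschitzOnBounded f)
    (hg : UniformlyLipschitzOnBounded g) :
    UniformlyLipschitzOnBounded fun i x => (f i x, g i x) := by
  intro r
  obtain ⟨C, hC⟩ := hf r
  obtain ⟨D, hD⟩ := hg r
  refine ⟨max C D, fun i => ⟨(hC i).1.prodMk (hD i).1, fun x hx => ?_⟩⟩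
  rw [mem_closedBall_zero_iff]
  exact max_le_max (mem_closedBall_zero_iff.1 ((hC i).2 hx))
    (mem_closedBall_zero_iff.1 ((hD i).2 hx))

theorem pi {κ : Type*} [Fintype κ] {H : κ → Type*} [∀ k, NormedAddCommGroup (H k)]
    {g : ∀ k, ι → E → H k} (hg : ∀ k, UniformlyLipschitzOnBounded (g k)) :
    UniformlyLipschitzOnBounded fun i x k => g k i x := by
  intro r
  choose C hC using fun k => hg k r
  have hle (k) : C k ≤ Finset.univ.sup C := Finset.le_sup (Finset.mem_univ k)
  refine ⟨Finset.univ.sup C, fun i => ⟨LipschitzOnWith.of_dist_le_mul fun x hx y hy => ?_,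
    fun x hx => ?_⟩⟩
  · exact (dist_pi_le_iff (by positivity)).2 fun k =>
      ((hC k i).1.weaken (hle k)).dist_le_mul x hx y hy
  · rw [mem_closedBall_zero_iff, pi_norm_le_iff_of_nonneg (by positivity)]
    exact fun k => mem_closedBall_zero_iff.1
      (closedBall_subset_closedBall (NNReal.coe_le_coe.2 (hle k)) ((hC k i).2 hx))

theorem continuous (hf : UniformlyLipschitzOnBounded f) (i : ι) : Continuous (f i) := by
  refine continuous_iff_continuousAt.2 fun x => ?_
  obtain ⟨C, hC⟩ := hf (‖x‖ + 1)
  refine (hC i).1.continuousOn.continuousAt (closedBall_mem_nhds_of_mem ?_)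
  simp

theorem of_contDiff [NormedSpace ℝ E] [ProperSpace E] [NormedSpace ℝ F] {g : E → F}
    (hg : ContDiff ℝ 1 g) : UniformlyLipschitzOnBounded fun _ : ι => g := by
  intro r
  have hr : IsCompact (closedBall (0 : E) r) := isCompact_closedBall 0 r
  obtain ⟨C, hC⟩ := hg.contDiffOn.exists_lipschitzOnWith one_ne_zero (convex_closedBall 0 r) hr
  obtain ⟨D, hD⟩ := hr.exists_bound_of_continuousOn hg.continuous.continuousOn
  refine ⟨max C D.toNNReal, fun _ => ⟨hC.weaken (le_max_left _ _), fun x hx => ?_⟩⟩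
  rw [mem_closedBall_zero_iff]
  exact (hD x hx).trans ((Real.le_coe_toNNReal D).trans (NNReal.coe_le_coe.2 (le_max_right _ _)))

theorem of_tendsto {l : Filter ι} [l.NeBot] {g : E → F} (hf : UniformlyLipschitzOnBounded f)
    (hg : ∀ x, Tendsto (fun i => f i x) l (𝓝 (g x))) {κ : Type*} :
    UniformlyLipschitzOnBounded fun _ : κ => g := by
  intro r
  obtain ⟨C, hC⟩ := hf r
  refine ⟨C, fun _ => ⟨LipschitzOnWith.of_dist_le_mul fun x hx y hy => ?_, fun x hx => ?_⟩⟩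
  · exact le_of_tendsto ((hg x).dist (hg y))
      (Eventually.of_forall fun i => (hC i).1.dist_le_mul x hx y hy)
  · exact isClosed_closedBall.mem_of_tendsto (hg x) (Eventually.of_forall fun i => (hC i).2 hx)

theorem of_deriv_le {A : ι → ℝ → ℝ} (hA : ∀ i, Differentiable ℝ (A i))
    (hbdd : ∀ m : ℕ, ∃ C : ℝ, ∀ i, ∀ x ∈ Icc (-(m : ℝ)) m, |A i x| + |deriv (A i) x| ≤ C) :
    UniformlyLipschitzOnBounded A := by
  intro r
  obtain ⟨m, hm⟩ := exists_nat_ge r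
  obtain ⟨C, hC⟩ := hbdd m
  have hball : closedBall (0 : ℝ) r ⊆ Icc (-(m : ℝ)) m := by
    rw [Real.closedBall_eq_Icc]
    exact Icc_subset_Icc (by linarith) (by linarith)
  refine ⟨C.toNNReal, fun i => ⟨?_, fun x hx => ?_⟩⟩
  · refine (convex_closedBall 0 r).lipschitzOnWith_of_nnnorm_deriv_le (fun x _ => hA i x)
      fun x hx => NNReal.le_toNNReal_of_coe_le ?_
    rw [coe_nnnorm, Real.norm_eq_abs]
    linarith [hC i x (hball hx), abs_nonneg (A i x)]
  · rw [mem_closedBall_zero_iff, Real.norm_eq_abs]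
    refine le_trans ?_ (Real.le_coe_toNNReal C)
    linarith [hC i x (hball hx), abs_nonneg (deriv (A i) x)]

end UniformlyLipschitzOnBounded

end UniformlyLipschitzOnBounded

section Derivative

theorem tendsto_clm_comp {ι E F G : Type*} {l : Filter ι} [NormedAddCommGroup E]
    [NormedSpace ℝ E] [NormedAddCommGroup F] [NormedSpace ℝ F] [NormedAddCommGroup G]
    [NormedSpace ℝ G] {f : ι → F →L[ℝ] G} {g : ι → E →L[ℝ] F} {f₀ : F →L[ℝ] G} {g₀ : E →L[ℝ] F}
    (hf : Tendsto f l (𝓝 f₀)) (hg : Tendsto g l (𝓝 g₀)) :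
    Tendsto (fun n => f n ∘L g n) l (𝓝 (f₀ ∘L g₀)) :=
  (isBoundedBilinearMap_comp.continuous.tendsto (f₀, g₀)).comp (hf.prodMk_nhds hg)

theorem norm_gradient {E : Type*} [NormedAddCommGroup E] [InnerProductSpace ℝ E] [CompleteSpace E]
    (f : E → ℝ) (x : E) : ‖gradient f x‖ = ‖fderiv ℝ f x‖ :=
  LinearIsometryEquiv.norm_map _ _

theorem norm_fderiv_prod_le {E F G : Type*} [NormedAddCommGroup E] [NormedSpace ℝ E]
    [NormedAddCommGroup F] [NormedSpace ℝ F] [NormedAddCommGroup G] [NormedSpace ℝ G]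
    {f : E × F → G} {x : E} {y : F} (hf : DifferentiableAt ℝ f (x, y)) :
    ‖fderiv ℝ f (x, y)‖ ≤
      ‖fderiv ℝ (fun x' => f (x', y)) x‖ + ‖fderiv ℝ (fun y' => f (x, y')) y‖ := by
  have hx := (hf.hasFDerivAt.comp x (hasFDerivAt_prodMk_left (𝕜 := ℝ) x y)).fderiv
  have hy := (hf.hasFDerivAt.comp y (hasFDerivAt_prodMk_right (𝕜 := ℝ) x y)).fderiv
  simp only [Function.comp_def] at hx hy
  rw [hx, hy]
  set D := fderiv ℝ f (x, y)
  refine D.opNorm_le_bound (by positivity) fun v => ?_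
  calc ‖D v‖ = ‖(D ∘L .inl ℝ E F) v.1 + (D ∘L .inr ℝ E F) v.2‖ := by
        simp [← map_add]
    _ ≤ ‖D ∘L .inl ℝ E F‖ * ‖v‖ + ‖D ∘L .inr ℝ E F‖ * ‖v‖ :=
        norm_add_le_of_le (ContinuousLinearMap.le_opNorm_of_le _ (norm_fst_le v))
          (ContinuousLinearMap.le_opNorm_of_le _ (norm_snd_le v))
    _ = (‖D ∘L .inl ℝ E F‖ + ‖D ∘L .inr ℝ E F‖) * ‖v‖ := (add_mul _ _ _).symm

end Derivative

section ParametricIntegral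

variable {X E : Type*} [TopologicalSpace X] [MeasurableSpace X] [OpensMeasurableSpace X]
  {μ : Measure X} [NormedAddCommGroup E] [NormedSpace ℝ E] [FiniteDimensional ℝ E]

theorem aestronglyMeasurable_of_hasFDerivAt {f : X → E → ℝ} (hf : Continuous f.uncurry) {x₀ : E}
    {f' : X → E →L[ℝ] ℝ} (hf' : ∀ᵐ p ∂μ, HasFDerivAt (f p) (f' p) x₀) :
    AEStronglyMeasurable f' μ := by
  borelize E
  have : ProperSpace E := FiniteDimensional.proper ℝ E
  refine ((measurable_fderiv_with_param ℝ hf).comp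
    (measurable_prodMk_right (y := x₀))).aestronglyMeasurable.congr ?_
  filter_upwards [hf'] with p hp using hp.fderiv

variable {b : X → ℝ}

theorem hasFDerivAt_integral_of_lipschitzOn {f : X → E → ℝ} (hf : Continuous f.uncurry)
    (hb : Integrable b μ) {x₀ : E} {s : Set E} (hs : s ∈ 𝓝 x₀)
    (hlip : ∀ᵐ p ∂μ, LipschitzOnWith (Real.nnabs (b p)) (f p) s)
    (hint : Integrable (fun p => f p x₀) μ) {f' : X → E →L[ℝ] ℝ}
    (hf' : ∀ᵐ p ∂μ, HasFDerivAt (f p) (f' p) x₀) :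
    HasFDerivAt (fun x => ∫ p, f p x ∂μ) (∫ p, f' p ∂μ) x₀ :=
  (hasFDerivAt_integral_of_dominated_loc_of_lip hs
    (Eventually.of_forall fun x => (hf.comp (by fun_prop : Continuous
      fun p => (p, x))).aestronglyMeasurable) hint
    (aestronglyMeasurable_of_hasFDerivAt hf hf') hlip hb hf').2

theorem tendsto_integral_of_hasFDerivAt_of_lipschitzOn {f : ℕ → X → E → ℝ}
    (hf : ∀ n, Continuous (f n).uncurry) (hb : Integrable b μ) {x : ℕ → E} {s : Set E}
    (hs : ∀ n, s ∈ 𝓝 (x n))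
    (hlip : ∀ n, ∀ᵐ p ∂μ, LipschitzOnWith (Real.nnabs (b p)) (f n p) s)
    {f' : ℕ → X → E →L[ℝ] ℝ} (hf' : ∀ n, ∀ᵐ p ∂μ, HasFDerivAt (f n p) (f' n p) (x n))
    {f'_lim : X → E →L[ℝ] ℝ} (hlim : ∀ᵐ p ∂μ, Tendsto (fun n => f' n p) atTop (𝓝 (f'_lim p))) :
    Tendsto (fun n => ∫ p, f' n p ∂μ) atTop (𝓝 (∫ p, f'_lim p ∂μ)) := by
  refine tendsto_integral_of_dominated_convergence (fun p => |b p|)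
    (fun n => aestronglyMeasurable_of_hasFDerivAt (hf n) (hf' n)) hb.abs (fun n => ?_) hlim
  filter_upwards [hf' n, hlip n] with p hderiv hlip using hderiv.le_of_lipschitzOn (hs n) hlip

end ParametricIntegral

section AlmostEverywhere

theorem exists_ae_norm_fst_le {E F : Type*} [NormedAddCommGroup E] [MeasurableSpace E]
    [TopologicalSpace F] [MeasurableSpace F] [HereditarilyLindelofSpace (E × F)]
    {μ : Measure (E × F)}
    (hsupp : Bornology.IsBounded {x | ∃ y, (x, y) ∈ μ.support}) :
    ∃ R : ℝ, ∀ᵐ p ∂μ, ‖p.1‖ ≤ R := by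
  obtain ⟨R, hR⟩ := hsupp.exists_norm_le
  refine ⟨R, ?_⟩
  filter_upwards [Measure.support_mem_ae] with p hp using hR p.1 ⟨p.2, hp⟩

theorem exists_mem_forall_ae_add_notMem {Ω ι : Type*} [MeasurableSpace Ω] {μ : Measure Ω}
    [SFinite μ] [Countable ι] {S : Set ℝ} (hS : S.Countable) {f : ι → Ω → ℝ}
    (hf : ∀ i, Measurable (f i)) {U : Set ℝ} (hU : IsOpen U) (hne : U.Nonempty) :
    ∃ t ∈ U, ∀ i, ∀ᵐ p ∂μ, f i p + t ∉ S := by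
  have hae : ∀ᵐ t : ℝ, ∀ i, ∀ᵐ p ∂μ, f i p + t ∉ S := by
    refine ae_all_iff.2 fun i => ?_
    have hmeas : MeasurableSet {q : Ω × ℝ | f i q.1 + q.2 ∉ S} :=
      (((hf i).comp measurable_fst).add measurable_snd) hS.measurableSet.compl
    refine (Measure.ae_ae_comm hmeas).1 (Eventually.of_forall fun p => ?_)
    exact (hS.preimage (add_right_injective (f i p))).ae_notMem volume
  obtain ⟨t, ht, htU⟩ := (Measure.dense_of_ae hae).exists_mem_open hU hne
  exact ⟨t, htU, ht⟩

end AlmostEverywhere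

section Network

variable {ℓ : ℕ → ℕ} {d k : ℕ}

/-- The functional `θ ↦ coord θ m`, bundled as a continuous linear map. -/
noncomputable def coordL (d m : ℕ) : EuclideanSpace ℝ (Fin d) →L[ℝ] ℝ :=
  if h : m < d then EuclideanSpace.proj ⟨m, h⟩ else 0

theorem coe_coordL (d m : ℕ) : ⇑(coordL d m) = fun θ => coord θ m := by
  unfold coordL coord
  split_ifs <;> rfl

@[fun_prop]
theorem contDiff_coord (m : ℕ) : ContDiff ℝ 1 fun θ : EuclideanSpace ℝ (Fin d) => coord θ m :=
  coe_coordL d m ▸ (coordL d m).contDiff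

@[fun_prop]
theorem continuous_coord (m : ℕ) : Continuous fun θ : EuclideanSpace ℝ (Fin d) => coord θ m :=
  (contDiff_coord m).continuous

theorem hasFDerivAt_coord (θ : EuclideanSpace ℝ (Fin d)) (m : ℕ) :
    HasFDerivAt (fun θ => coord θ m) (coordL d m) θ :=
  coe_coordL d m ▸ (coordL d m).hasFDerivAt

theorem contDiff_affineLayer (ℓ : ℕ → ℕ) (d k : ℕ) :
    ContDiff ℝ 1 fun q : EuclideanSpace ℝ (Fin d) × (Fin (ℓ k) → ℝ) =>
      affineLayer ℓ q.1 k q.2 := by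
  unfold affineLayer bias weight
  fun_prop

/-- The derivative of `affineLayer ℓ θ k v i` with respect to `θ`, where the input `v` depends on
`θ` as well and has the derivative `v'`. -/
noncomputable def affineDeriv (ℓ : ℕ → ℕ) (θ : EuclideanSpace ℝ (Fin d)) (k : ℕ) (v : Fin (ℓ k) → ℝ)
    (v' : Fin (ℓ k) → EuclideanSpace ℝ (Fin d) →L[ℝ] ℝ) (i : Fin (ℓ (k + 1))) :
    EuclideanSpace ℝ (Fin d) →L[ℝ] ℝ :=
  coordL d (ℓ (k + 1) * ℓ k + i + paramDim ℓ k) +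
    ∑ j, (weight ℓ θ k i j • v' j + v j • coordL d (i * ℓ k + j + paramDim ℓ k))

theorem hasFDerivAt_affineLayer {θ : EuclideanSpace ℝ (Fin d)}
    {v : EuclideanSpace ℝ (Fin d) → Fin (ℓ k) → ℝ}
    {v' : Fin (ℓ k) → EuclideanSpace ℝ (Fin d) →L[ℝ] ℝ}
    (hv : ∀ j, HasFDerivAt (fun θ => v θ j) (v' j) θ) (i : Fin (ℓ (k + 1))) :
    HasFDerivAt (fun θ => affineLayer ℓ θ k (v θ) i) (affineDeriv ℓ θ k (v θ) v' i) θ :=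
  (hasFDerivAt_coord θ _).add (HasFDerivAt.fun_sum fun j _ => (hasFDerivAt_coord θ _).mul (hv j))

theorem tendsto_affineDeriv {ι : Type*} {l : Filter ι} {θ : ι → EuclideanSpace ℝ (Fin d)}
    {v : ι → Fin (ℓ k) → ℝ} {v' : ι → Fin (ℓ k) → EuclideanSpace ℝ (Fin d) →L[ℝ] ℝ}
    {θ₀ : EuclideanSpace ℝ (Fin d)} {v₀ : Fin (ℓ k) → ℝ}
    {v₀' : Fin (ℓ k) → EuclideanSpace ℝ (Fin d) →L[ℝ] ℝ} (hθ : Tendsto θ l (𝓝 θ₀))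
    (hv : ∀ j, Tendsto (fun n => v n j) l (𝓝 (v₀ j)))
    (hv' : ∀ j, Tendsto (fun n => v' n j) l (𝓝 (v₀' j))) (i : Fin (ℓ (k + 1))) :
    Tendsto (fun n => affineDeriv ℓ (θ n) k (v n) (v' n) i) l
      (𝓝 (affineDeriv ℓ θ₀ k v₀ v₀' i)) := by
  refine tendsto_const_nhds.add (tendsto_finsetSum _ fun j _ => ?_)
  exact ((((continuous_coord _).tendsto θ₀).comp hθ).smul (hv' j)).add
    ((hv j).smul tendsto_const_nhds)

/-- The activation applied to layer `k` on the way to layer `k + 1`: the input layer `k = 0` is not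
activated. It makes the recursion for `preact` uniform in the layer. -/
def layerActivation (A : ℝ → ℝ) : ℕ → ℝ → ℝ
  | 0 => id
  | _ + 1 => A

/-- The slope of `layerActivation A k` if `a` is used as the slope of `A`. -/
def layerSlope (a : ℝ → ℝ) : ℕ → ℝ → ℝ
  | 0 => 1
  | _ + 1 => a

theorem preact_succ (A : ℝ → ℝ) (θ : EuclideanSpace ℝ (Fin d)) (x : EuclideanSpace ℝ (Fin (ℓ 0)))
    (k : ℕ) : preact ℓ A θ x (k + 1) =
      affineLayer ℓ θ k fun j => layerActivation A k (preact ℓ A θ x k j) := by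
  cases k <;> rfl

theorem continuous_layerActivation {A : ℝ → ℝ} (hA : Continuous A) :
    ∀ k, Continuous (layerActivation A k)
  | 0 => continuous_id
  | _ + 1 => hA

theorem continuous_preact {A : ℝ → ℝ} (hA : Continuous A) (d k : ℕ) :
    Continuous fun q : EuclideanSpace ℝ (Fin d) × EuclideanSpace ℝ (Fin (ℓ 0)) =>
      preact ℓ A q.1 q.2 k := by
  induction k with
  | zero => exact continuous_pi fun i => by simp only [preact]; fun_prop
  | succ k ih =>
    simp only [preact_succ]
    exact (contDiff_affineLayer ℓ d k).continuous.comp (continuous_fst.prodMk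
      (continuous_pi fun j => (continuous_layerActivation hA k).comp
        ((continuous_apply j).comp ih)))

theorem uniformlyLipschitzOnBounded_layerActivation {ι : Type*} {A : ι → ℝ → ℝ}
    (hA : UniformlyLipschitzOnBounded A) :
    ∀ k, UniformlyLipschitzOnBounded fun i => layerActivation (A i) k
  | 0 => .of_contDiff contDiff_id
  | _ + 1 => hA

theorem uniformlyLipschitzOnBounded_preact {ι : Type*} {A : ι → ℝ → ℝ}
    (hA : UniformlyLipschitzOnBounded A) (ℓ : ℕ → ℕ) (d k : ℕ) :
    UniformlyLipschitzOnBounded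
      fun i (q : EuclideanSpace ℝ (Fin d) × EuclideanSpace ℝ (Fin (ℓ 0))) =>
        preact ℓ (A i) q.1 q.2 k := by
  induction k with
  | zero =>
    exact .of_contDiff (contDiff_pi.2 fun j => by simp only; fun_prop)
  | succ k ih =>
    have hact : UniformlyLipschitzOnBounded
        fun i (v : Fin (ℓ k) → ℝ) j => layerActivation (A i) k (v j) :=
      .pi fun j => (uniformlyLipschitzOnBounded_layerActivation hA k).comp
        (.of_contDiff (g := fun v : Fin (ℓ k) → ℝ => v j) (by fun_prop))
    have haff := UniformlyLipschitzOnBounded.of_contDiff (ι := ι) (contDiff_affineLayer ℓ d k)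
    simpa only [preact_succ, Function.comp_def] using
      haff.comp (.prodMk (.of_contDiff contDiff_fst) (hact.comp ih))

/-- The derivative of `preact ℓ A θ x k i` with respect to `θ`, as the chain rule computes it from a
slope function `a` for `A`. -/
noncomputable def preactDeriv (ℓ : ℕ → ℕ) (A a : ℝ → ℝ) (θ : EuclideanSpace ℝ (Fin d))
    (x : EuclideanSpace ℝ (Fin (ℓ 0))) :
    (k : ℕ) → Fin (ℓ k) → EuclideanSpace ℝ (Fin d) →L[ℝ] ℝ
  | 0 => 0
  | k + 1 => affineDeriv ℓ θ k (fun j => layerActivation A k (preact ℓ A θ x k j))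
      fun j => layerSlope a k (preact ℓ A θ x k j) • preactDeriv ℓ A a θ x k j

variable {x : EuclideanSpace ℝ (Fin (ℓ 0))}

theorem hasFDerivAt_preact {A a : ℝ → ℝ} {θ : EuclideanSpace ℝ (Fin d)}
    (h : ∀ j < k, ∀ i, HasDerivAt (layerActivation A j) (layerSlope a j (preact ℓ A θ x j i))
      (preact ℓ A θ x j i)) (i : Fin (ℓ k)) :
    HasFDerivAt (fun θ => preact ℓ A θ x k i) (preactDeriv ℓ A a θ x k i) θ := by
  induction k with
  | zero => exact hasFDerivAt_const (x i) θ
  | succ k ih =>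
    simp only [preact_succ]
    exact hasFDerivAt_affineLayer (fun j => (h k k.lt_succ_self j).comp_hasFDerivAt θ
      (ih (fun m hm => h m (hm.trans k.lt_succ_self)) j)) i

theorem eventually_preact_preactDeriv_eq {ι : Type*} {l : Filter ι} {A a : ι → ℝ → ℝ}
    {A₀ a₀ : ℝ → ℝ} (h : ∀ y, ∀ᶠ n in l, A n y = A₀ y ∧ a n y = a₀ y)
    (θ : EuclideanSpace ℝ (Fin d)) (x : EuclideanSpace ℝ (Fin (ℓ 0))) (k : ℕ) :
    ∀ᶠ n in l, preact ℓ (A n) θ x k = preact ℓ A₀ θ x k ∧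
      preactDeriv ℓ (A n) (a n) θ x k = preactDeriv ℓ A₀ a₀ θ x k := by
  have hlayer : ∀ k y, ∀ᶠ n in l, layerActivation (A n) k y = layerActivation A₀ k y ∧
      layerSlope (a n) k y = layerSlope a₀ k y
    | 0, _ => Eventually.of_forall fun _ => ⟨rfl, rfl⟩
    | _ + 1, y => h y
  induction k with
  | zero => exact Eventually.of_forall fun _ => ⟨rfl, rfl⟩
  | succ k ih =>
    filter_upwards [ih, eventually_all.2 fun j => hlayer k (preact ℓ A₀ θ x k j)]
      with n ⟨hval, hderiv⟩ hn
    simp only [preact_succ, preactDeriv, hval, hderiv, hn, and_self]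

theorem tendsto_preactDeriv {ι : Type*} {l : Filter ι} {A a : ℝ → ℝ} (hA : Continuous A)
    {θ : ι → EuclideanSpace ℝ (Fin d)} {θ₀ : EuclideanSpace ℝ (Fin d)}
    (hθ : Tendsto θ l (𝓝 θ₀))
    (hslope : ∀ j < k, ∀ i, Tendsto (fun n => layerSlope a j (preact ℓ A (θ n) x j i)) l
      (𝓝 (layerSlope a j (preact ℓ A θ₀ x j i)))) (i : Fin (ℓ k)) :
    Tendsto (fun n => preactDeriv ℓ A a (θ n) x k i) l (𝓝 (preactDeriv ℓ A a θ₀ x k i)) := by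
  induction k with
  | zero => exact tendsto_const_nhds
  | succ k ih =>
    have hact (j) : Continuous fun θ : EuclideanSpace ℝ (Fin d) =>
        layerActivation A k (preact ℓ A θ x k j) :=
      (continuous_layerActivation hA k).comp ((continuous_apply j).comp
        ((continuous_preact hA d k).comp (by fun_prop : Continuous fun θ => (θ, x))))
    exact tendsto_affineDeriv hθ (fun j => ((hact j).tendsto θ₀).comp hθ) (fun j =>
      (hslope k k.lt_succ_self j).smul (ih (fun m hm => hslope m (hm.trans k.lt_succ_self)) j)) i

end Network

section SampleLoss

variable {ℓ : ℕ → ℕ} {L : ℕ}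

theorem continuous_realization {A : ℝ → ℝ} (hA : Continuous A) :
    Continuous fun q : EuclideanSpace ℝ (Fin (paramDim ℓ L)) × EuclideanSpace ℝ (Fin (ℓ 0)) =>
      realization ℓ L A q.1 q.2 :=
  (PiLp.continuous_toLp 2 _).comp (continuous_preact hA _ L)

theorem uniformlyLipschitzOnBounded_realization {ι : Type*} {A : ι → ℝ → ℝ}
    (hA : UniformlyLipschitzOnBounded A) (ℓ : ℕ → ℕ) (L : ℕ) :
    UniformlyLipschitzOnBounded
      fun n (q : EuclideanSpace ℝ (Fin (paramDim ℓ L)) × EuclideanSpace ℝ (Fin (ℓ 0))) =>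
        realization ℓ L (A n) q.1 q.2 :=
  (UniformlyLipschitzOnBounded.of_contDiff (PiLp.contDiff_toLp (𝕜 := ℝ) (n := 1) (p := 2))).comp
    (uniformlyLipschitzOnBounded_preact hA ℓ _ L)

/-- The derivative of `realization ℓ L A θ x` with respect to `θ`, with `a` as the slope of `A`. -/
noncomputable def realizationDeriv (ℓ : ℕ → ℕ) (L : ℕ) (A a : ℝ → ℝ)
    (θ : EuclideanSpace ℝ (Fin (paramDim ℓ L))) (x : EuclideanSpace ℝ (Fin (ℓ 0))) :
    EuclideanSpace ℝ (Fin (paramDim ℓ L)) →L[ℝ] EuclideanSpace ℝ (Fin (ℓ L)) :=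
  ∑ i, .toSpanSingleton ℝ (EuclideanSpace.single i 1) ∘L preactDeriv ℓ A a θ x L i

theorem hasFDerivAt_realization {A a : ℝ → ℝ} {θ : EuclideanSpace ℝ (Fin (paramDim ℓ L))}
    {x : EuclideanSpace ℝ (Fin (ℓ 0))}
    (h : ∀ k < L, ∀ i, HasDerivAt (layerActivation A k) (layerSlope a k (preact ℓ A θ x k i))
      (preact ℓ A θ x k i)) :
    HasFDerivAt (fun θ => realization ℓ L A θ x) (realizationDeriv ℓ L A a θ x) θ := by
  rw [← hasFDerivWithinAt_univ, hasFDerivWithinAt_euclidean]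
  intro i
  rw [hasFDerivWithinAt_univ]
  refine (hasFDerivAt_preact h i).congr_fderiv ?_
  ext v
  simp [realizationDeriv]

/-- The contribution of the sample `p = (x, y)` to the risk at the parameters `θ`. -/
def sampleLoss (ℓ : ℕ → ℕ) (L : ℕ)
    (H : EuclideanSpace ℝ (Fin (ℓ L)) × EuclideanSpace ℝ (Fin (paramDim ℓ L)) ×
      EuclideanSpace ℝ (Fin (ℓ L)) → ℝ)
    (A : ℝ → ℝ) (θ : EuclideanSpace ℝ (Fin (paramDim ℓ L)))
    (p : EuclideanSpace ℝ (Fin (ℓ 0)) × EuclideanSpace ℝ (Fin (ℓ L))) : ℝ :=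
  H (realization ℓ L A θ p.1, θ, p.2)

/-- The derivative of `sampleLoss ℓ L H A θ p` with respect to `θ`, with `a` as the slope of `A`. -/
noncomputable def sampleLossDeriv (ℓ : ℕ → ℕ) (L : ℕ)
    (H : EuclideanSpace ℝ (Fin (ℓ L)) × EuclideanSpace ℝ (Fin (paramDim ℓ L)) ×
      EuclideanSpace ℝ (Fin (ℓ L)) → ℝ)
    (A a : ℝ → ℝ) (θ : EuclideanSpace ℝ (Fin (paramDim ℓ L)))
    (p : EuclideanSpace ℝ (Fin (ℓ 0)) × EuclideanSpace ℝ (Fin (ℓ L))) :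
    EuclideanSpace ℝ (Fin (paramDim ℓ L)) →L[ℝ] ℝ :=
  fderiv ℝ H (realization ℓ L A θ p.1, θ, p.2) ∘L
    (.inl ℝ _ _ ∘L realizationDeriv ℓ L A a θ p.1 + .inr ℝ _ _ ∘L .inl ℝ _ _)

variable {H : EuclideanSpace ℝ (Fin (ℓ L)) × EuclideanSpace ℝ (Fin (paramDim ℓ L)) ×
    EuclideanSpace ℝ (Fin (ℓ L)) → ℝ}
  {p : EuclideanSpace ℝ (Fin (ℓ 0)) × EuclideanSpace ℝ (Fin (ℓ L))}

theorem continuous_sampleLoss (hH : Continuous H) {A : ℝ → ℝ} (hA : Continuous A) :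
    Continuous fun q : (EuclideanSpace ℝ (Fin (ℓ 0)) × EuclideanSpace ℝ (Fin (ℓ L))) ×
      EuclideanSpace ℝ (Fin (paramDim ℓ L)) => sampleLoss ℓ L H A q.2 q.1 :=
  hH.comp (((continuous_realization hA).comp (continuous_snd.prodMk continuous_fst.fst)).prodMk
    (continuous_snd.prodMk continuous_fst.snd))

theorem hasFDerivAt_sampleLoss (hH : Differentiable ℝ H) {A a : ℝ → ℝ}
    {θ : EuclideanSpace ℝ (Fin (paramDim ℓ L))}
    (h : ∀ k < L, ∀ i, HasDerivAt (layerActivation A k) (layerSlope a k (preact ℓ A θ p.1 k i))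
      (preact ℓ A θ p.1 k i)) :
    HasFDerivAt (fun θ => sampleLoss ℓ L H A θ p) (sampleLossDeriv ℓ L H A a θ p) θ := by
  have harg := (hasFDerivAt_realization h).prodMk
    ((hasFDerivAt_id θ).prodMk (hasFDerivAt_const p.2 θ))
  refine ((hH _).hasFDerivAt.comp θ harg).congr_fderiv ?_
  rw [sampleLossDeriv]
  congr 1
  ext v <;> simp

theorem eventually_sampleLossDeriv_eq {ι : Type*} {l : Filter ι} {A a : ι → ℝ → ℝ}
    {A₀ a₀ : ℝ → ℝ} (h : ∀ y, ∀ᶠ n in l, A n y = A₀ y ∧ a n y = a₀ y)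
    (θ : EuclideanSpace ℝ (Fin (paramDim ℓ L))) :
    ∀ᶠ n in l, sampleLossDeriv ℓ L H (A n) (a n) θ p = sampleLossDeriv ℓ L H A₀ a₀ θ p := by
  filter_upwards [eventually_preact_preactDeriv_eq h θ p.1 L] with n hn
  simp only [sampleLossDeriv, realization, realizationDeriv, hn]

theorem tendsto_sampleLossDeriv (hH : ContDiff ℝ 1 H) {ι : Type*} {l : Filter ι}
    {A a : ℝ → ℝ} (hA : Continuous A)
    {θ : ι → EuclideanSpace ℝ (Fin (paramDim ℓ L))} {θ₀ : EuclideanSpace ℝ (Fin (paramDim ℓ L))}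
    (hθ : Tendsto θ l (𝓝 θ₀))
    (hslope : ∀ k < L, ∀ i, Tendsto (fun n => layerSlope a k (preact ℓ A (θ n) p.1 k i)) l
      (𝓝 (layerSlope a k (preact ℓ A θ₀ p.1 k i)))) :
    Tendsto (fun n => sampleLossDeriv ℓ L H A a (θ n) p) l
      (𝓝 (sampleLossDeriv ℓ L H A a θ₀ p)) := by
  have hrealization : Tendsto (fun n => realizationDeriv ℓ L A a (θ n) p.1) l
      (𝓝 (realizationDeriv ℓ L A a θ₀ p.1)) :=
    tendsto_finsetSum _ fun i _ =>
      tendsto_clm_comp tendsto_const_nhds (tendsto_preactDeriv hA hθ hslope i)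
  have harg : Continuous fun θ => (realization ℓ L A θ p.1, θ, p.2) :=
    ((continuous_realization hA).comp (continuous_id.prodMk continuous_const)).prodMk
      (continuous_id.prodMk continuous_const)
  have hfderiv := ((hH.continuous_fderiv one_ne_zero).comp harg).tendsto θ₀ |>.comp hθ
  exact tendsto_clm_comp hfderiv ((tendsto_clm_comp tendsto_const_nhds hrealization).add_const _)

end SampleLoss

section Risk

variable {ℓ : ℕ → ℕ} {L : ℕ}
  {H : EuclideanSpace ℝ (Fin (ℓ L)) × EuclideanSpace ℝ (Fin (paramDim ℓ L)) ×
    EuclideanSpace ℝ (Fin (ℓ L)) → ℝ}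
  {μ : Measure (EuclideanSpace ℝ (Fin (ℓ 0)) × EuclideanSpace ℝ (Fin (ℓ L)))}

/-- `H` is locally Lipschitz in its first two arguments with a constant that, as a function of the
third argument, is `μ`-integrable. This is the domination needed to differentiate the risk under the
integral sign. -/
def IntegrablyLipschitzOnBounded
    (H : EuclideanSpace ℝ (Fin (ℓ L)) × EuclideanSpace ℝ (Fin (paramDim ℓ L)) ×
      EuclideanSpace ℝ (Fin (ℓ L)) → ℝ)
    (μ : Measure (EuclideanSpace ℝ (Fin (ℓ 0)) × EuclideanSpace ℝ (Fin (ℓ L)))) : Prop :=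
  ∀ r : ℝ, ∃ g : EuclideanSpace ℝ (Fin (ℓ 0)) × EuclideanSpace ℝ (Fin (ℓ L)) → ℝ,
    Integrable g μ ∧ ∀ᵐ p ∂μ, LipschitzOnWith (Real.nnabs (g p))
      (fun q : EuclideanSpace ℝ (Fin (ℓ L)) × EuclideanSpace ℝ (Fin (paramDim ℓ L)) =>
        H (q.1, q.2, p.2)) (closedBall 0 r)

theorem exists_lipschitzOnWith_sampleLoss {ι : Type*} {A : ι → ℝ → ℝ}
    (hA : UniformlyLipschitzOnBounded A)
    {R : ℝ} (hR : ∀ᵐ p ∂μ, ‖p.1‖ ≤ R) (hHμ : IntegrablyLipschitzOnBounded H μ) (r : ℝ) :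
    ∃ b : EuclideanSpace ℝ (Fin (ℓ 0)) × EuclideanSpace ℝ (Fin (ℓ L)) → ℝ,
      Integrable b μ ∧ ∀ n, ∀ᵐ p ∂μ,
        LipschitzOnWith (Real.nnabs (b p)) (fun θ => sampleLoss ℓ L H (A n) θ p)
          (closedBall 0 r) := by
  obtain ⟨C, hC⟩ := (uniformlyLipschitzOnBounded_realization hA ℓ L).prodMk
    (.of_contDiff contDiff_fst) (max r R)
  obtain ⟨g, hg, hglip⟩ := hHμ C
  refine ⟨fun p => g p * C, hg.mul_const _, fun n => ?_⟩
  filter_upwards [hR, hglip] with p hp hgp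
  have hmaps : MapsTo (fun θ : EuclideanSpace ℝ (Fin (paramDim ℓ L)) => (θ, p.1)) (closedBall 0 r)
      (closedBall 0 (max r R)) := fun θ hθ =>
    mem_closedBall_zero_iff.2 (max_le_max (mem_closedBall_zero_iff.1 hθ) hp)
  have hcomp := hgp.comp ((hC n).1.comp (LipschitzWith.prodMk_right p.1).lipschitzOnWith hmaps)
    ((hC n).2.comp hmaps)
  rw [map_mul, Real.nnabs_coe, ← mul_one C]
  exact hcomp

theorem integrable_sampleLoss (hH : Continuous H) {ι : Type*} {A : ι → ℝ → ℝ}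
    (hA : UniformlyLipschitzOnBounded A) {R : ℝ} (hR : ∀ᵐ p ∂μ, ‖p.1‖ ≤ R)
    (hHμ : IntegrablyLipschitzOnBounded H μ) (hint : Integrable (fun p => H (0, 0, p.2)) μ)
    (n : ι) (θ : EuclideanSpace ℝ (Fin (paramDim ℓ L))) :
    Integrable (sampleLoss ℓ L H (A n) θ) μ := by
  obtain ⟨C, hC⟩ := (uniformlyLipschitzOnBounded_realization hA ℓ L).prodMk
    (.of_contDiff contDiff_fst) (max ‖θ‖ R)
  obtain ⟨g, hg, hglip⟩ := hHμ C
  have hmeas : AEStronglyMeasurable (sampleLoss ℓ L H (A n) θ) μ :=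
    ((continuous_sampleLoss hH (hA.continuous n)).comp
      (continuous_id.prodMk (continuous_const (y := θ)))).aestronglyMeasurable
  refine (hint.norm.add (hg.norm.mul_const C)).mono' hmeas ?_
  filter_upwards [hR, hglip] with p hp hgp
  have hmem : (realization ℓ L (A n) θ p.1, θ) ∈ closedBall 0 (C : ℝ) :=
    (hC n).2 (x := (θ, p.1)) (mem_closedBall_zero_iff.2 (max_le_max le_rfl hp))
  have hlip := hgp.norm_sub_le hmem (mem_closedBall_self C.coe_nonneg)
  calc ‖sampleLoss ℓ L H (A n) θ p‖
      ≤ ‖H (0, 0, p.2)‖ + ‖sampleLoss ℓ L H (A n) θ p - H (0, 0, p.2)‖ := norm_le_insert' _ _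
    _ ≤ ‖H (0, 0, p.2)‖ + ‖g p‖ * C := by
        gcongr
        refine hlip.trans ?_
        rw [sub_zero]
        exact mul_le_mul_of_nonneg_left (mem_closedBall_zero_iff.1 hmem) (NNReal.coe_nonneg _)

/-- The slope function `a` serves as the derivative of `A` at almost every preactivation to which
the activation is applied, so that `sampleLossDeriv` computes the derivative of almost every sample
loss. -/
def IsSlopeAE (μ : Measure (EuclideanSpace ℝ (Fin (ℓ 0)) × EuclideanSpace ℝ (Fin (ℓ L))))
    (A a : ℝ → ℝ) (θ : EuclideanSpace ℝ (Fin (paramDim ℓ L))) : Prop :=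
  ∀ᵐ p ∂μ, ∀ k < L, ∀ i, HasDerivAt (layerActivation A k) (layerSlope a k (preact ℓ A θ p.1 k i))
    (preact ℓ A θ p.1 k i)

theorem hasFDerivAt_risk (hH : ContDiff ℝ 1 H) {ι : Type*} {A : ι → ℝ → ℝ}
    (hA : UniformlyLipschitzOnBounded A) {R : ℝ} (hR : ∀ᵐ p ∂μ, ‖p.1‖ ≤ R)
    (hHμ : IntegrablyLipschitzOnBounded H μ) (hint : Integrable (fun p => H (0, 0, p.2)) μ)
    {n : ι} {a : ℝ → ℝ} {θ : EuclideanSpace ℝ (Fin (paramDim ℓ L))}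
    (hslope : IsSlopeAE μ (A n) a θ) :
    HasFDerivAt (risk ℓ L H μ (A n)) (∫ p, sampleLossDeriv ℓ L H (A n) a θ p ∂μ) θ := by
  obtain ⟨b, hb, hlip⟩ := exists_lipschitzOnWith_sampleLoss hA hR hHμ (‖θ‖ + 1)
  refine hasFDerivAt_integral_of_lipschitzOn
    (continuous_sampleLoss hH.continuous (hA.continuous n)) hb (closedBall_mem_nhds_of_mem ?_)
    (hlip n) (integrable_sampleLoss hH.continuous hA hR hHμ hint n θ) ?_
  · simp
  · filter_upwards [hslope] with p hp
      using hasFDerivAt_sampleLoss (hH.differentiable one_ne_zero) hp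

theorem tendsto_integral_sampleLossDeriv_of_tendsto (hH : ContDiff ℝ 1 H) {A : ℕ → ℝ → ℝ}
    (hA : UniformlyLipschitzOnBounded A) {R : ℝ} (hR : ∀ᵐ p ∂μ, ‖p.1‖ ≤ R)
    (hHμ : IntegrablyLipschitzOnBounded H μ) {a : ℕ → ℝ → ℝ}
    {θ : ℕ → EuclideanSpace ℝ (Fin (paramDim ℓ L))} {θ₀ : EuclideanSpace ℝ (Fin (paramDim ℓ L))}
    (hθ : Tendsto θ atTop (𝓝 θ₀)) (hslope : ∀ n, IsSlopeAE μ (A n) (a n) (θ n))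
    {D : EuclideanSpace ℝ (Fin (ℓ 0)) × EuclideanSpace ℝ (Fin (ℓ L)) →
      EuclideanSpace ℝ (Fin (paramDim ℓ L)) →L[ℝ] ℝ}
    (hD : ∀ᵐ p ∂μ, Tendsto (fun n => sampleLossDeriv ℓ L H (A n) (a n) (θ n) p) atTop (𝓝 (D p))) :
    Tendsto (fun n => ∫ p, sampleLossDeriv ℓ L H (A n) (a n) (θ n) p ∂μ) atTop
      (𝓝 (∫ p, D p ∂μ)) := by
  obtain ⟨r, hr⟩ := (isBounded_range_of_tendsto θ hθ).exists_norm_le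
  obtain ⟨b, hb, hlip⟩ := exists_lipschitzOnWith_sampleLoss hA hR hHμ (r + 1)
  refine tendsto_integral_of_hasFDerivAt_of_lipschitzOn (x := θ)
    (fun n => continuous_sampleLoss hH.continuous (hA.continuous n)) hb
    (fun n => closedBall_mem_nhds_of_mem ?_) hlip (fun n => ?_) hD
  · rw [mem_ball_zero_iff]
    linarith [hr (θ n) (mem_range_self n)]
  · filter_upwards [hslope n] with p hp
      using hasFDerivAt_sampleLoss (hH.differentiable one_ne_zero) hp

end Risk

section Limits

variable {ℓ : ℕ → ℕ} {L : ℕ}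
  {H : EuclideanSpace ℝ (Fin (ℓ L)) × EuclideanSpace ℝ (Fin (paramDim ℓ L)) ×
    EuclideanSpace ℝ (Fin (ℓ L)) → ℝ}
  {μ : Measure (EuclideanSpace ℝ (Fin (ℓ 0)) × EuclideanSpace ℝ (Fin (ℓ L)))}

theorem hasDerivAt_layerActivation {A a : ℝ → ℝ} {x : ℝ} (h : HasDerivAt A (a x) x) :
    ∀ k, HasDerivAt (layerActivation A k) (layerSlope a k x) x
  | 0 => hasDerivAt_id x
  | _ + 1 => h

theorem isSlopeAE_deriv {A : ℝ → ℝ} (hA : Differentiable ℝ A)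
    (θ : EuclideanSpace ℝ (Fin (paramDim ℓ L))) : IsSlopeAE μ A (deriv A) θ :=
  Eventually.of_forall fun _ k _ _ => hasDerivAt_layerActivation (hA _).hasDerivAt k

theorem tendsto_fderiv_risk (hH : ContDiff ℝ 1 H) {A : ℕ → ℝ → ℝ} {A₀ a : ℝ → ℝ}
    (hA : UniformlyLipschitzOnBounded A) (hdiff : ∀ n, Differentiable ℝ (A n))
    (hconv : ∀ x, ∀ᶠ n in atTop, A n x = A₀ x ∧ deriv (A n) x = a x)
    {R : ℝ} (hR : ∀ᵐ p ∂μ, ‖p.1‖ ≤ R) (hHμ : IntegrablyLipschitzOnBounded H μ)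
    (hint : Integrable (fun p => H (0, 0, p.2)) μ) (θ : EuclideanSpace ℝ (Fin (paramDim ℓ L))) :
    Tendsto (fun n => fderiv ℝ (risk ℓ L H μ (A n)) θ) atTop
      (𝓝 (∫ p, sampleLossDeriv ℓ L H A₀ a θ p ∂μ)) := by
  simp only [(hasFDerivAt_risk hH hA hR hHμ hint (isSlopeAE_deriv (hdiff _) θ)).fderiv]
  exact tendsto_integral_sampleLossDeriv_of_tendsto hH hA hR hHμ (tendsto_const_nhds (x := θ))
    (fun n => isSlopeAE_deriv (hdiff n) θ)
    (Eventually.of_forall fun _ =>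
      tendsto_nhds_of_eventually_eq (eventually_sampleLossDeriv_eq hconv θ))

end Limits

section GenericPerturbation

variable {ℓ : ℕ → ℕ} {d j k L : ℕ}

/-- The direction in parameter space that moves all biases of the affine map from layer `k` to layer
`k + 1` at unit speed and does not move any earlier parameter. Moving all later parameters as well
keeps the formula simple. -/
def biasShift (ℓ : ℕ → ℕ) (d k : ℕ) : EuclideanSpace ℝ (Fin d) :=
  WithLp.toLp 2 fun m => if ℓ (k + 1) * ℓ k + paramDim ℓ k ≤ m then 1 else 0

theorem coord_biasShift_of_lt {m : ℕ} (hm : m < ℓ (k + 1) * ℓ k + paramDim ℓ k) :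
    coord (biasShift ℓ d k) m = 0 := by
  simp [coord, biasShift, hm]

theorem coord_biasShift_of_le {m : ℕ} (hmd : m < d) (hm : ℓ (k + 1) * ℓ k + paramDim ℓ k ≤ m) :
    coord (biasShift ℓ d k) m = 1 := by
  simp [coord, biasShift, hmd, hm]

theorem weight_biasShift (hjk : j ≤ k) (i : Fin (ℓ (j + 1))) (i' : Fin (ℓ j)) :
    weight ℓ (biasShift ℓ d k) j i i' = 0 := by
  refine coord_biasShift_of_lt ?_
  rcases hjk.lt_or_eq with hjk | rfl
  · exact (weight_index_lt ℓ hjk i i').trans_le (Nat.le_add_left _ _)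
  · have hi : (i + 1) * ℓ j ≤ ℓ (j + 1) * ℓ j := Nat.mul_le_mul_right _ i.isLt
    have hi' := i'.isLt
    rw [add_mul, one_mul] at hi
    omega

theorem affineLayer_biasShift_of_lt (hjk : j < k) (v : Fin (ℓ j) → ℝ) (i : Fin (ℓ (j + 1))) :
    affineLayer ℓ (biasShift ℓ d k) j v i = 0 := by
  have hbias : bias ℓ (biasShift ℓ d k) j i = 0 :=
    coord_biasShift_of_lt ((bias_index_lt ℓ hjk i).trans_le (Nat.le_add_left _ _))
  simp only [affineLayer, hbias, weight_biasShift hjk.le, zero_mul, Finset.sum_const_zero, add_zero]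

theorem affineLayer_biasShift_self (hk : k < L) (v : Fin (ℓ k) → ℝ) (i : Fin (ℓ (k + 1))) :
    affineLayer ℓ (biasShift ℓ (paramDim ℓ L) k) k v i = 1 := by
  have hbias : bias ℓ (biasShift ℓ (paramDim ℓ L) k) k i = 1 :=
    coord_biasShift_of_le (bias_index_lt ℓ hk i) (by omega)
  simp only [affineLayer, hbias, weight_biasShift le_rfl, zero_mul, Finset.sum_const_zero, add_zero]

theorem affineLayer_add_smul (θ u : EuclideanSpace ℝ (Fin d)) (t : ℝ) (v : Fin (ℓ k) → ℝ)
    (i : Fin (ℓ (k + 1))) :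
    affineLayer ℓ (θ + t • u) k v i = affineLayer ℓ θ k v i + t * affineLayer ℓ u k v i := by
  have hcoord (m : ℕ) : coord (θ + t • u) m = coord θ m + t * coord u m := by
    simpa only [coe_coordL, map_smul, smul_eq_mul] using (coordL d m).map_add θ (t • u)
  simp only [affineLayer, bias, weight, hcoord, add_mul, mul_add, Finset.sum_add_distrib,
    Finset.mul_sum, mul_assoc]
  ring

theorem preact_add_smul_biasShift_of_le (hjk : j ≤ k) (A : ℝ → ℝ) (θ : EuclideanSpace ℝ (Fin d))
    (t : ℝ) (x : EuclideanSpace ℝ (Fin (ℓ 0))) :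
    preact ℓ A (θ + t • biasShift ℓ d k) x j = preact ℓ A θ x j := by
  induction j with
  | zero => rfl
  | succ j ih =>
    ext i
    rw [preact_succ, preact_succ, ih (j.le_succ.trans hjk), affineLayer_add_smul,
      affineLayer_biasShift_of_lt hjk, mul_zero, add_zero]

theorem preact_succ_add_smul_biasShift (hk : k < L) (A : ℝ → ℝ)
    (θ : EuclideanSpace ℝ (Fin (paramDim ℓ L))) (t : ℝ) (x : EuclideanSpace ℝ (Fin (ℓ 0)))
    (i : Fin (ℓ (k + 1))) :
    preact ℓ A (θ + t • biasShift ℓ (paramDim ℓ L) k) x (k + 1) i =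
      preact ℓ A θ x (k + 1) i + t := by
  rw [preact_succ, preact_succ, preact_add_smul_biasShift_of_le le_rfl, affineLayer_add_smul,
    affineLayer_biasShift_self hk, mul_one]

theorem exists_abs_preact_sub_le {A : ℝ → ℝ}
    (hA : UniformlyLipschitzOnBounded fun _ : Unit => A) (R : ℝ) (θ : EuclideanSpace ℝ (Fin d))
    (k : ℕ) :
    ∃ C : ℝ≥0, ∀ θ' ∈ closedBall θ 1, ∀ x : EuclideanSpace ℝ (Fin (ℓ 0)), ‖x‖ ≤ R →
      ∀ i, |preact ℓ A θ' x k i - preact ℓ A θ x k i| ≤ C * dist θ' θ := by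
  obtain ⟨C, hC⟩ := uniformlyLipschitzOnBounded_preact hA ℓ d k (max (‖θ‖ + 1) R)
  refine ⟨C, fun θ' hθ' x hx i => ?_⟩
  have hmem {θ' : EuclideanSpace ℝ (Fin d)} (hθ' : ‖θ'‖ ≤ ‖θ‖ + 1) :
      (θ', x) ∈ closedBall 0 (max (‖θ‖ + 1) R) :=
    mem_closedBall_zero_iff.2 (max_le_max hθ' hx)
  have hlip := (hC ()).1.dist_le_mul _ (hmem (norm_le_of_mem_closedBall hθ')) _
    (hmem (θ' := θ) (by linarith))
  refine (dist_le_pi_dist _ _ i).trans (hlip.trans_eq ?_)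
  simp [Prod.dist_eq]

/-- The parameters `θ'` are a generic one-sided perturbation of `θ` up to layer `k`: for almost
every sample, each preactivation in the layers `1, …, k` has moved strictly in the direction of the
sign of `z` and avoids the exceptional set `S`. -/
def IsGenericShift {Ω : Type*} [MeasurableSpace Ω] (μ : Measure (EuclideanSpace ℝ (Fin (ℓ 0)) × Ω))
    (S : Set ℝ) (A : ℝ → ℝ) (z : ℝ) (k : ℕ) (θ θ' : EuclideanSpace ℝ (Fin d)) : Prop :=
  ∀ j < k, ∀ i, ∀ᵐ p ∂μ, 0 < z * (preact ℓ A θ' p.1 (j + 1) i - preact ℓ A θ p.1 (j + 1) i) ∧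
    preact ℓ A θ' p.1 (j + 1) i ∉ S

variable {Ω : Type*} [MeasurableSpace Ω] {μ : Measure (EuclideanSpace ℝ (Fin (ℓ 0)) × Ω)}
  {S : Set ℝ} {A : ℝ → ℝ} {z R : ℝ}

theorem IsGenericShift.exists_succ [SFinite μ] (hS : S.Countable) (hA : Continuous A) (hz : z ≠ 0)
    (hR : ∀ᵐ p ∂μ, ‖p.1‖ ≤ R) (hk : k < L) {θ θ' : EuclideanSpace ℝ (Fin (paramDim ℓ L))} {D δ : ℝ}
    (hD₀ : 0 ≤ D) (hδ : 0 < δ)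
    (hD : ∀ x : EuclideanSpace ℝ (Fin (ℓ 0)), ‖x‖ ≤ R →
      ∀ i, |preact ℓ A θ' x (k + 1) i - preact ℓ A θ x (k + 1) i| ≤ D)
    (hθ' : IsGenericShift μ S A z k θ θ') :
    ∃ t ∈ ball (0 : ℝ) (D + δ),
      IsGenericShift μ S A z (k + 1) θ (θ' + t • biasShift ℓ (paramDim ℓ L) k) := by
  -- the lower bound lets the shift dominate the displacement `D`, with the sign of `z`
  let U : Set ℝ := {t | |z| * D < z * t} ∩ ball 0 (D + δ)
  have hU : IsOpen U := (isOpen_lt continuous_const (continuous_const_mul z)).inter isOpen_ball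
  have hne : U.Nonempty := by
    refine ⟨SignType.sign z * (D + δ / 2), ?_, ?_⟩
    · rw [mem_ofPred_eq, ← mul_assoc, self_mul_sign]
      gcongr
      linarith
    · rw [mem_ball_zero_iff, Real.norm_eq_abs, abs_lt]
      rcases hz.lt_or_gt with hz | hz
      · simp only [sign_neg hz, SignType.coe_neg_one]
        constructor <;> linarith
      · simp only [sign_pos hz, SignType.coe_one]
        constructor <;> linarith
  have hmeas (i : Fin (ℓ (k + 1))) :
      Measurable fun p : EuclideanSpace ℝ (Fin (ℓ 0)) × Ω => preact ℓ A θ' p.1 (k + 1) i :=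
    (((continuous_apply i).comp (continuous_preact hA _ (k + 1))).comp
      (continuous_const.prodMk continuous_id)).measurable.comp measurable_fst
  obtain ⟨t, ⟨htD, ht⟩, htS⟩ := exists_mem_forall_ae_add_notMem (μ := μ) hS hmeas hU hne
  refine ⟨t, ht, fun j hj i => ?_⟩
  rcases (Nat.lt_succ_iff.1 hj).lt_or_eq with hjk | rfl
  · simpa only [preact_add_smul_biasShift_of_le hjk] using hθ' j hjk i
  · filter_upwards [hR, htS i] with p hp hpS
    rw [preact_succ_add_smul_biasShift hk]
    refine ⟨?_, hpS⟩
    have hdisp := hD p.1 hp i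
    have hzD := mul_le_mul_of_nonneg_left hdisp (abs_nonneg z)
    rw [← abs_mul] at hzD
    rw [mem_ofPred_eq] at htD
    linarith [neg_abs_le (z * (preact ℓ A θ' p.1 (j + 1) i - preact ℓ A θ p.1 (j + 1) i))]

theorem mem_closure_isGenericShift [SFinite μ] (hS : S.Countable)
    (hA : UniformlyLipschitzOnBounded fun _ : Unit => A) (hz : z ≠ 0) (hR : ∀ᵐ p ∂μ, ‖p.1‖ ≤ R)
    (θ : EuclideanSpace ℝ (Fin (paramDim ℓ L))) (hk : k ≤ L) :
    θ ∈ closure {θ' | IsGenericShift μ S A z k θ θ'} := by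
  induction k with
  | zero => exact subset_closure fun j hj => absurd hj (Nat.not_lt_zero j)
  | succ k ih =>
    set u := biasShift ℓ (paramDim ℓ L) k
    obtain ⟨C, hC⟩ := exists_abs_preact_sub_le hA R θ (k + 1)
    refine Metric.mem_closure_iff.2 fun ε hε => ?_
    obtain ⟨δ, hδ, hδ₁, hδε⟩ : ∃ δ > 0, δ ≤ 1 ∧ δ + (C * δ + δ) * ‖u‖ ≤ ε := by
      have hpos : 0 < 1 + (C + 1) * ‖u‖ := by positivity
      refine ⟨min 1 (ε / (1 + (C + 1) * ‖u‖)), by positivity, min_le_left _ _, ?_⟩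
      have := (le_div_iff₀ hpos).1 (min_le_right 1 (ε / (1 + (C + 1) * ‖u‖)))
      linarith
    obtain ⟨θ', hθ', hdist⟩ := Metric.mem_closure_iff.1 (ih (Nat.le_of_succ_le hk)) δ hδ
    rw [dist_comm] at hdist
    obtain ⟨t, ht, hshift⟩ := hθ'.exists_succ hS (hA.continuous ()) hz hR hk
      (D := C * δ) (by positivity) hδ fun x hx i =>
        (hC θ' (hdist.le.trans hδ₁) x hx i).trans (by gcongr)
    refine ⟨θ' + t • u, hshift, ?_⟩
    rw [mem_ball_zero_iff, Real.norm_eq_abs] at ht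
    calc dist θ (θ' + t • u) ≤ dist θ' θ + |t| * ‖u‖ := by
          rw [dist_comm, dist_eq_norm, dist_eq_norm, ← Real.norm_eq_abs, ← norm_smul,
            add_sub_right_comm]
          exact norm_add_le _ _
      _ < δ + (C * δ + δ) * ‖u‖ := add_lt_add_of_lt_of_le hdist (by gcongr)
      _ ≤ ε := hδε

end GenericPerturbation

section GradientOfLimit

variable {ℓ : ℕ → ℕ} {L : ℕ}
  {H : EuclideanSpace ℝ (Fin (ℓ L)) × EuclideanSpace ℝ (Fin (paramDim ℓ L)) ×
    EuclideanSpace ℝ (Fin (ℓ L)) → ℝ}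
  {μ : Measure (EuclideanSpace ℝ (Fin (ℓ 0)) × EuclideanSpace ℝ (Fin (ℓ L)))}
  {S : Set ℝ} {A a : ℝ → ℝ} {z : ℝ}

theorem IsGenericShift.isSlopeAE (hderiv : ∀ x ∉ S, HasDerivAt A (a x) x)
    {θ θ' : EuclideanSpace ℝ (Fin (paramDim ℓ L))} (h : IsGenericShift μ S A z L θ θ') :
    IsSlopeAE μ A a θ' := by
  refine ae_all_iff.2 fun k => ae_all_iff.2 fun hk => ae_all_iff.2 fun i => ?_
  cases k with
  | zero => exact Eventually.of_forall fun p => hasDerivAt_id _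
  | succ k =>
    filter_upwards [h k (k.lt_succ_self.trans hk) i] with p hp
    exact hderiv _ hp.2

theorem tendsto_sampleLossDeriv_of_isGenericShift (hH : ContDiff ℝ 1 H) (hA : Continuous A)
    (hone : ∀ x, ContinuousWithinAt a {y | 0 < z * (y - x)} x)
    {θ : ℕ → EuclideanSpace ℝ (Fin (paramDim ℓ L))} {θ₀ : EuclideanSpace ℝ (Fin (paramDim ℓ L))}
    (hθ : Tendsto θ atTop (𝓝 θ₀)) (hshift : ∀ n, IsGenericShift μ S A z L θ₀ (θ n)) :
    ∀ᵐ p ∂μ, Tendsto (fun n => sampleLossDeriv ℓ L H A a (θ n) p) atTop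
      (𝓝 (sampleLossDeriv ℓ L H A a θ₀ p)) := by
  have hae : ∀ᵐ p ∂μ, ∀ n, ∀ k < L, ∀ i,
      0 < z * (preact ℓ A (θ n) p.1 (k + 1) i - preact ℓ A θ₀ p.1 (k + 1) i) := by
    simp only [ae_all_iff]
    exact fun n k hk i => (hshift n k hk i).mono fun p hp => hp.1
  filter_upwards [hae] with p hp
  refine tendsto_sampleLossDeriv hH hA hθ fun k hk i => ?_
  cases k with
  | zero => exact tendsto_const_nhds
  | succ k =>
    have hpreact : Continuous fun θ : EuclideanSpace ℝ (Fin (paramDim ℓ L)) =>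
        preact ℓ A θ p.1 (k + 1) i :=
      ((continuous_apply i).comp (continuous_preact hA _ (k + 1))).comp
        (continuous_id.prodMk continuous_const)
    exact (hone _).tendsto.comp (tendsto_nhdsWithin_iff.2
      ⟨(hpreact.tendsto θ₀).comp hθ,
        Eventually.of_forall fun n => hp n k (k.lt_succ_self.trans hk) i⟩)

theorem fderiv_risk_eq_integral_sampleLossDeriv [SFinite μ] (hH : ContDiff ℝ 1 H)
    (hA : UniformlyLipschitzOnBounded fun _ : Unit => A) (hS : S.Countable)
    (hderiv : ∀ x ∉ S, HasDerivAt A (a x) x) (hz : z ≠ 0)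
    (hone : ∀ x, ContinuousWithinAt a {y | 0 < z * (y - x)} x)
    {R : ℝ} (hR : ∀ᵐ p ∂μ, ‖p.1‖ ≤ R) (hHμ : IntegrablyLipschitzOnBounded H μ)
    (hint : Integrable (fun p => H (0, 0, p.2)) μ) {θ : EuclideanSpace ℝ (Fin (paramDim ℓ L))}
    (hrisk : ContDiffAt ℝ 1 (risk ℓ L H μ A) θ) :
    fderiv ℝ (risk ℓ L H μ A) θ = ∫ p, sampleLossDeriv ℓ L H A a θ p ∂μ := by
  obtain ⟨φ, hshift, hφ⟩ :=
    mem_closure_iff_seq_limit.1 (mem_closure_isGenericShift hS hA hz hR θ le_rfl)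
  have hslope (n : ℕ) : IsSlopeAE μ A a (φ n) := (hshift n).isSlopeAE hderiv
  have hfderiv : Tendsto (fun n => fderiv ℝ (risk ℓ L H μ A) (φ n)) atTop
      (𝓝 (fderiv ℝ (risk ℓ L H μ A) θ)) :=
    (hrisk.continuousAt_fderiv one_ne_zero).tendsto.comp hφ
  simp only [fun n => (hasFDerivAt_risk hH hA hR hHμ hint (n := ()) (hslope n)).fderiv] at hfderiv
  exact tendsto_nhds_unique hfderiv
    (tendsto_integral_sampleLossDeriv_of_tendsto hH (hA.reindex fun _ => ()) hR hHμ hφ hslope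
      (tendsto_sampleLossDeriv_of_isGenericShift hH (hA.continuous ()) hone hφ hshift))

end GradientOfLimit

section ActivationSlope

variable {S : Finset ℝ} {γ : S → ℝ} {f a : ℝ → ℝ} {x z : ℝ}

theorem hasDerivAt_genDeriv (hf : ContDiffOn ℝ 1 f ((S : Set ℝ)ᶜ)) (hx : x ∉ S) :
    HasDerivAt f (genDeriv S γ f x) x := by
  have hmem : ((S : Set ℝ)ᶜ) ∈ 𝓝 x := S.finite_toSet.isClosed.isOpen_compl.mem_nhds hx
  rw [genDeriv, dif_neg hx]
  exact ((hf.contDiffAt hmem).differentiableAt one_ne_zero).hasDerivAt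

theorem continuousAt_genDeriv (hf : ContDiffOn ℝ 1 f ((S : Set ℝ)ᶜ)) (hx : x ∉ S) :
    ContinuousAt (genDeriv S γ f) x := by
  have hopen : IsOpen ((S : Set ℝ)ᶜ) := S.finite_toSet.isClosed.isOpen_compl
  refine ((hf.continuousOn_deriv_of_isOpen hopen le_rfl).continuousAt (hopen.mem_nhds hx)).congr ?_
  filter_upwards [hopen.mem_nhds hx] with y hy
  have hy : y ∉ S := hy
  rw [genDeriv, dif_neg hy]

theorem continuousWithinAt_of_oneSidedJump_eq_zero (hz : z ≠ 0) (h : oneSidedJump S a z = 0)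
    (hx : x ∈ S) : ContinuousWithinAt a {y | 0 < z * (y - x)} x := by
  have hlimsup : limsup (fun t : ℝ => ENNReal.ofReal |a (x + z * t) - a x|) (𝓝[>] (0 : ℝ)) = 0 :=
    Finset.sum_eq_zero_iff.1 h x hx
  have hjump : Tendsto (fun t => a (x + z * t)) (𝓝[>] 0) (𝓝 (a x)) := by
    rw [tendsto_iff_edist_tendsto_0]
    simp only [edist_dist, Real.dist_eq]
    exact tendsto_of_le_liminf_of_limsup_le bot_le hlimsup.le
  have hparam : Tendsto (fun y => (y - x) / z) (𝓝[{y | 0 < z * (y - x)}] x) (𝓝[>] 0) := by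
    refine tendsto_nhdsWithin_iff.2 ⟨?_, ?_⟩
    · have hcont : Continuous fun y => (y - x) / z := by fun_prop
      simpa using (hcont.tendsto x).mono_left nhdsWithin_le_nhds
    · filter_upwards [self_mem_nhdsWithin] with y hy
      rw [mem_Ioi, ← mul_div_mul_left _ _ hz]
      exact div_pos hy (mul_self_pos.2 hz)
  refine (hjump.comp hparam).congr fun y => ?_
  rw [Function.comp_apply, mul_div_cancel₀ _ hz, add_sub_cancel]

theorem exists_forall_continuousWithinAt_genDeriv (hf : ContDiffOn ℝ 1 f ((S : Set ℝ)ᶜ))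
    (h : min (oneSidedJump S (genDeriv S γ f) (-1)) (oneSidedJump S (genDeriv S γ f) 1) = 0) :
    ∃ z : ℝ, z ≠ 0 ∧ ∀ x, ContinuousWithinAt (genDeriv S γ f) {y | 0 < z * (y - x)} x := by
  obtain ⟨z, hz, hjump⟩ : ∃ z : ℝ, z ≠ 0 ∧ oneSidedJump S (genDeriv S γ f) z = 0 := by
    rcases min_eq_bot.1 h with h | h
    · exact ⟨-1, by norm_num, h⟩
    · exact ⟨1, one_ne_zero, h⟩
  refine ⟨z, hz, fun x => ?_⟩
  by_cases hx : x ∈ S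
  · exact continuousWithinAt_of_oneSidedJump_eq_zero hz hjump hx
  · exact (continuousAt_genDeriv hf hx).continuousWithinAt

end ActivationSlope

section Growth

variable {ℓ : ℕ → ℕ} {L : ℕ}
  {H : EuclideanSpace ℝ (Fin (ℓ L)) × EuclideanSpace ℝ (Fin (paramDim ℓ L)) ×
    EuclideanSpace ℝ (Fin (ℓ L)) → ℝ}
  {μ : Measure (EuclideanSpace ℝ (Fin (ℓ 0)) × EuclideanSpace ℝ (Fin (ℓ L)))}

theorem integrablyLipschitzOnBounded_of_norm_gradient_div_le [IsFiniteMeasure μ]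
    (hH : Differentiable ℝ H) (hint : Integrable (fun p => H (0, 0, p.2)) μ)
    (hgrowth : ∀ r : ℝ, 0 < r → ∃ C : ℝ,
      ∀ z : EuclideanSpace ℝ (Fin (ℓ L)), (∀ i, |z i| ≤ r) →
      ∀ θ : EuclideanSpace ℝ (Fin (paramDim ℓ L)), (∀ i, |θ i| ≤ r) →
      ∀ x y, (x, y) ∈ μ.support →
        (‖gradient (fun z' => H (z', θ, y)) z‖ + ‖gradient (fun θ' => H (z, θ', y)) θ‖) /
          (1 + |H (0, 0, y)|) ≤ C) :
    IntegrablyLipschitzOnBounded H μ := by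
  intro r
  obtain ⟨C, hC⟩ := hgrowth (max r 1) (by positivity)
  refine ⟨fun p => C * (1 + |H (0, 0, p.2)|), ((integrable_const 1).add hint.abs).const_mul C, ?_⟩
  filter_upwards [Measure.support_mem_ae] with p hp
  have hdiff : Differentiable ℝ fun q : EuclideanSpace ℝ (Fin (ℓ L)) ×
      EuclideanSpace ℝ (Fin (paramDim ℓ L)) => H (q.1, q.2, p.2) := hH.comp (by fun_prop)
  refine Convex.lipschitzOnWith_of_nnnorm_fderiv_le (𝕜 := ℝ) (fun q _ => hdiff q)
    (fun ⟨z, θ⟩ hq => ?_) (convex_closedBall 0 r)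
  obtain ⟨hz, hθ⟩ := max_le_iff.1 (mem_closedBall_zero_iff.1 hq)
  have hcoord {n : ℕ} {v : EuclideanSpace ℝ (Fin n)} (hv : ‖v‖ ≤ r) (i : Fin n) :
      |v i| ≤ max r 1 :=
    (PiLp.norm_apply_le v i).trans (hv.trans (le_max_left r 1))
  have hgrad := (div_le_iff₀ (by positivity)).1 (hC z (hcoord hz) θ (hcoord hθ) p.1 p.2 hp)
  rw [norm_gradient, norm_gradient] at hgrad
  exact ((norm_fderiv_prod_le (hdiff (z, θ))).trans hgrad).trans (le_abs_self _)

theorem realization_zero (hL : 0 < L) (A : ℝ → ℝ) (x : EuclideanSpace ℝ (Fin (ℓ 0))) :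
    realization ℓ L A 0 x = 0 := by
  obtain ⟨k, rfl⟩ := Nat.exists_eq_add_one.2 hL
  ext i
  simp [realization, preact_succ, affineLayer, bias, weight, coord]

end Growth

end ANN

open ANN in
theorem mainTheorem4_general {ℓ : ℕ → ℕ} {L : ℕ} {S : Set ℝ} (hS : S.Countable)
    {A : ℕ → ℝ → ℝ} {A₀ a : ℝ → ℝ} (hA : UniformlyLipschitzOnBounded A)
    (hdiff : ∀ n, Differentiable ℝ (A n))
    (hconv : ∀ x, ∀ᶠ n in atTop, A n x = A₀ x ∧ deriv (A n) x = a x)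
    (hderiv : ∀ x ∉ S, HasDerivAt A₀ (a x) x)
    {z : ℝ} (hz : z ≠ 0) (hone : ∀ x, ContinuousWithinAt a {y | 0 < z * (y - x)} x)
    {μ : Measure (EuclideanSpace ℝ (Fin (ℓ 0)) × EuclideanSpace ℝ (Fin (ℓ L)))} [SFinite μ]
    {R : ℝ} (hR : ∀ᵐ p ∂μ, ‖p.1‖ ≤ R)
    {H : EuclideanSpace ℝ (Fin (ℓ L)) × EuclideanSpace ℝ (Fin (paramDim ℓ L)) ×
      EuclideanSpace ℝ (Fin (ℓ L)) → ℝ}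
    (hH : ContDiff ℝ 1 H) (hHμ : IntegrablyLipschitzOnBounded H μ)
    (hint : Integrable (fun p => H (0, 0, p.2)) μ) {θ : EuclideanSpace ℝ (Fin (paramDim ℓ L))}
    (hrisk : ContDiffAt ℝ 1 (risk ℓ L H μ A₀) θ) :
    (∀ n, DifferentiableAt ℝ (risk ℓ L H μ (A n)) θ) ∧
      Tendsto (fun n => gradient (risk ℓ L H μ (A n)) θ) atTop
        (𝓝 (gradient (risk ℓ L H μ A₀) θ)) := by
  have hA₀ : UniformlyLipschitzOnBounded fun _ : Unit => A₀ := hA.of_tendsto fun x =>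
    tendsto_nhds_of_eventually_eq ((hconv x).mono fun n hn => hn.1)
  have hlim := tendsto_fderiv_risk hH hA hdiff hconv hR hHμ hint θ
  rw [← fderiv_risk_eq_integral_sampleLossDeriv hH hA₀ hS hderiv hz hone hR hHμ hint hrisk] at hlim
  exact ⟨fun n => (hasFDerivAt_risk hH hA hR hHμ hint
      (isSlopeAE_deriv (hdiff n) θ)).differentiableAt,
    ((InnerProductSpace.toDual ℝ _).symm.continuous.tendsto _).comp hlim⟩

theorem mainTheorem4
    (ℓ : ℕ → ℕ) (hℓ : ∀ k, 0 < ℓ k) (L : ℕ) (hL : 0 < L)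
    (S : Finset ℝ) (γ : S → ℝ)
    -- `A 0` is the activation, `A n` for `n ≥ 1` are its continuously differentiable approximations
    (A : ℕ → ℝ → ℝ)
    (hA : ∀ n, 1 ≤ n → ContDiff ℝ 1 (A n))
    (hA0 : ContDiffOn ℝ 1 (A 0) ((S : Set ℝ)ᶜ))
    (hconv : ∀ x : ℝ, ∃ m : ℕ, 1 ≤ m ∧ ∀ n, m ≤ n →
      A n x = A 0 x ∧ deriv (A n) x = ANN.genDeriv S γ (A 0) x)
    (hbdd : ∀ m : ℕ, ∃ C : ℝ, ∀ n, 1 ≤ n → ∀ x ∈ Set.Icc (-(m : ℝ)) (m : ℝ),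
      |A n x| + |deriv (A n) x| ≤ C)
    (hjump : min (ANN.oneSidedJump S (ANN.genDeriv S γ (A 0)) (-1))
      (ANN.oneSidedJump S (ANN.genDeriv S γ (A 0)) 1) = 0)
    (μ : Measure (EuclideanSpace ℝ (Fin (ℓ 0)) × EuclideanSpace ℝ (Fin (ℓ L))))
    [IsFiniteMeasure μ]
    (hsupp : Bornology.IsBounded
      {x : EuclideanSpace ℝ (Fin (ℓ 0)) | ∃ y, (x, y) ∈ μ.support})
    (H : EuclideanSpace ℝ (Fin (ℓ L)) × EuclideanSpace ℝ (Fin (ANN.paramDim ℓ L)) ×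
      EuclideanSpace ℝ (Fin (ℓ L)) → ℝ)
    (hH : ContDiff ℝ 1 H)
    (hint : ∀ n θ, Integrable (fun p => H (ANN.realization ℓ L (A n) θ p.1, θ, p.2)) μ)
    (hgrowth : ∀ r : ℝ, 0 < r →
      ∀ X : EuclideanSpace ℝ (Fin (ℓ L)), (∀ i, |X i| ≤ r) →
      ∀ Θ : EuclideanSpace ℝ (Fin (ANN.paramDim ℓ L)), (∀ i, |Θ i| ≤ r) →
      ∃ C : ℝ, ∀ z : EuclideanSpace ℝ (Fin (ℓ L)), (∀ i, |z i| ≤ r) →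
        ∀ θ : EuclideanSpace ℝ (Fin (ANN.paramDim ℓ L)), (∀ i, |θ i| ≤ r) →
        ∀ x y, (x, y) ∈ μ.support →
          (‖gradient (fun z' => H (z', θ, y)) z‖ + ‖gradient (fun θ' => H (z, θ', y)) θ‖) /
            (1 + |H (X, Θ, y)|) ≤ C)
    (G : EuclideanSpace ℝ (Fin (ANN.paramDim ℓ L)) → EuclideanSpace ℝ (Fin (ANN.paramDim ℓ L)))
    -- `G θ` is the limit of the gradients at `θ` of the objective functions with activation `A n`
    -- whenever these gradients exist and converge, and arbitrary otherwise
    (hG : ∀ θ w, ∀ v : ℕ → EuclideanSpace ℝ (Fin (ANN.paramDim ℓ L)),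
      (∀ n, 1 ≤ n → HasGradientAt (ANN.risk ℓ L H μ (A n)) (v n) θ) →
      Tendsto v atTop (𝓝 w) → G θ = w) :
    ∀ U : Set (EuclideanSpace ℝ (Fin (ANN.paramDim ℓ L))), IsOpen U →
      ContDiffOn ℝ 1 (ANN.risk ℓ L H μ (A 0)) U →
      ∀ θ ∈ U, G θ = gradient (ANN.risk ℓ L H μ (A 0)) θ := by
  intro U hU hrisk θ hθ
  obtain ⟨z, hz, hone⟩ := ANN.exists_forall_continuousWithinAt_genDeriv hA0 hjump
  obtain ⟨R, hR⟩ := ANN.exists_ae_norm_fst_le hsupp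
  have hint₀ : Integrable (fun p => H (0, 0, p.2)) μ := by
    simpa only [ANN.realization_zero hL] using hint 0 0
  have hHμ := ANN.integrablyLipschitzOnBounded_of_norm_gradient_div_le
    (hH.differentiable one_ne_zero) hint₀
    fun r hr => hgrowth r hr 0 (by simp [hr.le]) 0 (by simp [hr.le])
  have hAdiff (n : ℕ) : Differentiable ℝ (A (n + 1)) :=
    (hA (n + 1) n.succ_pos).differentiable one_ne_zero
  have hconv' (x : ℝ) : ∀ᶠ n in atTop,
      A (n + 1) x = A 0 x ∧ deriv (A (n + 1)) x = ANN.genDeriv S γ (A 0) x := by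
    obtain ⟨m, -, hm⟩ := hconv x
    exact eventually_atTop.2 ⟨m, fun n hn => hm (n + 1) (hn.trans n.le_succ)⟩
  have hALip : ANN.UniformlyLipschitzOnBounded fun n => A (n + 1) := .of_deriv_le hAdiff fun m =>
    (hbdd m).imp fun C hC n => hC (n + 1) n.succ_pos
  obtain ⟨hriskDiff, hlim⟩ := mainTheorem4_general S.countable_toSet hALip hAdiff hconv'
    (fun x hx => ANN.hasDerivAt_genDeriv hA0 hx) hz hone hR hH hHμ hint₀
    (hrisk.contDiffAt (hU.mem_nhds hθ))
  refine hG θ _ (fun n => gradient (ANN.risk ℓ L H μ (A n)) θ) (fun n hn => ?_)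
    ((tendsto_add_atTop_iff_nat 1).1 hlim)
  obtain ⟨n, rfl⟩ := Nat.exists_eq_add_one.2 hn
  exact (hriskDiff n).hasGradientAt
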